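/- For a finite set $\mathcal P$ of points and a finite set $\mathcal H$ of hyperplanes in $\mathbb R^d$, let $I(\mathcal P,\mathcal H)$ be the number of pairs $(p,h)\in\mathcal P\times\mathcal H$ with $p\in h$. The incidence graph of $\mathcal P\times\mathcal H$ is the bipartite graph with sides $\mathcal P$ and $\mathcal H$ whose edges are these pairs; it contains a copy of $K_{s,r}$ if some $s$ distinct points of $\mathcal P$ all lie on each of some $r$ distinct hyperplanes of $\mathcal H$. **Theorem.** For every integer $d\ge 2$ there exists a constant $t$, depending only on $d$, such that the following hold for every $\varepsilon>0$. (a) For every $C$ there is a constant $c>0$, depending only on $d,\varepsilon,C$, such that for all positive integers $m,n$ with $m\le Cn^d$ there exist a set $\mathcal P$ of $m$ points and a set $\mathcal H$ of $n$ hyperplanes, both in $\mathbb R^d$, such that the incidence graph of $\mathcal P\times\mathcal H$ contains no $K_{2,t+1}$ and $$I(\mathcal P,\mathcal H)\ \ge\ c\left(m^{\frac{2d-2}{2d-1}}\,n^{\frac{d}{2d-1}-\varepsilon}+m+n\right).$$ (b) If $d\ge 4$, then for every $C$ there is a constant $c>0$, depending only on $d,\varepsilon,C$, such that for all positive integers $m,n$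 with $m\le Cn^{d-2}$ there exist a set $\mathcal P$ of $m$ points and a set $\mathcal H$ of $n$ hyperplanes, both in $\mathbb R^d$, such that the incidence graph of $\mathcal P\times\mathcal H$ contains no $K_{3,t+1}$ and $$I(\mathcal P,\mathcal H)\ \ge\ c\left(m^{\frac{3d^2-9d+2}{(d-2)(3d-1)}}\,n^{\frac{2d}{3d-1}-\varepsilon}+m+n\right).$$ -/

import Mathlib

/-- A hyperplane of `ℝ^d`: an affine subspace of dimension `d - 1`. -/
def IsHyperplane {d : ℕ} (h : AffineSubspace ℝ (EuclideanSpace ℝ (Fin d))) : Prop :=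
  (h : Set (EuclideanSpace ℝ (Fin d))).Nonempty ∧ Module.finrank ℝ h.direction + 1 = d

/-- The number `I(P, H)` of incidences: pairs `(p, h) ∈ P × H` with `p ∈ h`. -/
noncomputable def incidences {d : ℕ} (P : Finset (EuclideanSpace ℝ (Fin d)))
    (H : Finset (AffineSubspace ℝ (EuclideanSpace ℝ (Fin d)))) : ℕ :=
  Set.ncard {q : EuclideanSpace ℝ (Fin d) × AffineSubspace ℝ (EuclideanSpace ℝ (Fin d)) |
    q.1 ∈ P ∧ q.2 ∈ H ∧ q.1 ∈ q.2}

/-- The incidence graph of `P × H`, a bipartite graph with sides `P` and `H`, contains a copy of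
`K_{s,t}`: there are `s` distinct points of `P` that all lie on each of `t` distinct elements
of `H`. -/
def ContainsK {d : ℕ} (s t : ℕ) (P : Finset (EuclideanSpace ℝ (Fin d)))
    (H : Finset (AffineSubspace ℝ (EuclideanSpace ℝ (Fin d)))) : Prop :=
  ∃ S ⊆ P, ∃ T ⊆ H, S.card = s ∧ T.card = t ∧ ∀ p ∈ S, ∀ h ∈ T, p ∈ h

/-! Take `m` lattice points in a box of side `a` and all hyperplanes through them with normals in a
fixed set `N` of `q ^ (d * s)` pairwise non-proportional integer vectors with entries `O(q ^ (d -
1))`. Each point lies on `q ^ (d * s)` of them, while a normal `u` takes only `O(a * q ^ (d - 1))`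
values `u · x` on the box, so there are `O(a * q ^ (d * s + d - 1))` hyperplanes. With `a` of order
`m ^ (1 / g)`, solving for `q` in terms of `n` gives the exponents. For `s = 1` all box points serve
(`g = d`); for `s = 2` the points lie on a sphere, so no three are collinear (`g = d - 2`).

Hyperplanes through `s + 1` affinely independent points have normals in a rational subspace of
codimension `s`. So `N` must meet every such subspace in boundedly many vectors
(`exists_evasive_lattice_set`). Modulo a prime `p` of order `q ^ d`, such a set of size `p ^ s` is a
popular fibre of `d - 1 - s` weighted power sums with distinct degrees `2 ^ j`
(`card_le_of_powerSum_const`). Scaling by Dirichlet's pigeonhole gives small integer vectors, and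
independence modulo `p` passes to `ℚ`. -/

/-! ### Bounding point sets by reduced monomials -/

/-- If every `x j ^ e j` is a combination of monomials of weight less than `M = e j * w j`, then
every monomial in the `x j` is a combination of those with exponents less than `e j`. -/
theorem prod_pow_mem_span_reduced {F B ι : Type*} [Field F] [CommRing B] [Algebra F B] [Fintype ι]
    [DecidableEq ι] (x : ι → B) (e w : ι → ℕ) (M : ℕ) (hM : ∀ j, e j * w j = M)
    (hx : ∀ j, x j ^ e j ∈
      Submodule.span F {y | ∃ a : ι → ℕ, ∑ j, a j * w j < M ∧ y = ∏ j, x j ^ a j})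
    (a : ι → ℕ) :
    ∏ j, x j ^ a j ∈
      Submodule.span F (Set.range fun b : (∀ j, Fin (e j)) => ∏ j, x j ^ (b j : ℕ)) := by
  induction hn : ∑ j, a j * w j using Nat.strong_induction_on generalizing a with
  | _ n ih =>
    by_cases h : ∀ j, a j < e j
    · exact Submodule.subset_span ⟨fun j => ⟨a j, h j⟩, rfl⟩
    push Not at h
    obtain ⟨j, hj⟩ := h
    obtain ⟨a', rfl⟩ : ∃ a' : ι → ℕ, a = a' + Pi.single j (e j) := by
      refine ⟨a - Pi.single j (e j), ?_⟩
      funext i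
      by_cases hi : i = j
      · subst hi; simp; omega
      · simp [hi]
    have hsum : ∑ i, a' i * w i + M = n := by
      rw [← hn, ← hM j]
      simp [add_mul, Finset.sum_add_distrib, Pi.single_apply]
    have hprod : ∏ i, x i ^ (a' + Pi.single j (e j) : ι → ℕ) i = x j ^ e j * ∏ i, x i ^ a' i := by
      simp only [Pi.add_apply, pow_add, Finset.prod_mul_distrib]
      rw [mul_comm]
      congr 1
      rw [Finset.prod_eq_single j]
      · simp
      · intro b _ hb; simp [hb]
      · simp
    rw [hprod]
    -- Replacing the factor `x j ^ e j`, of weight `M`, by lighter monomials strictly lowers the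
    -- total weight, so the induction applies.
    refine Submodule.span_induction
      (p := fun y _ => y * ∏ i, x i ^ a' i ∈ Submodule.span F
        (Set.range fun b : (∀ j, Fin (e j)) => ∏ j, x j ^ (b j : ℕ))) ?_ ?_ ?_ ?_ (hx j)
    · rintro y ⟨b, hb, rfl⟩
      rw [← Finset.prod_mul_distrib]
      simp_rw [← pow_add]
      refine ih (∑ i, (b i + a' i) * w i) ?_ (fun i => b i + a' i) rfl
      simp only [add_mul, Finset.sum_add_distrib]
      omega
    · simp
    · intro y z _ _ hy hz
      rw [add_mul]; exact Submodule.add_mem _ hy hz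
    · intro c y _ hy
      rw [smul_mul_assoc]; exact Submodule.smul_mem _ _ hy

/-- The `n`-th power of a combination of those `x j` of weight at most `W` is a combination of
monomials of weight at most `n * W`. -/
theorem pow_mem_span_weight {F B ι : Type*} [Field F] [CommRing B] [Algebra F B] [Fintype ι]
    [DecidableEq ι] (x : ι → B) (w : ι → ℕ) (W : ℕ) (y : B)
    (hy : y ∈ Submodule.span F (x '' {i | w i ≤ W})) (n : ℕ) :
    y ^ n ∈ Submodule.span F
      {y | ∃ a : ι → ℕ, ∑ j, a j * w j ≤ n * W ∧ y = ∏ j, x j ^ a j} := by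
  induction n with
  | zero => exact Submodule.subset_span ⟨0, by simp, by simp⟩
  | succ n ih =>
    rw [pow_succ]
    have h := Submodule.mul_mem_mul ih hy
    rw [Submodule.span_mul_span] at h
    refine Submodule.span_mono ?_ h
    rintro _ ⟨_, ⟨a, ha, rfl⟩, _, ⟨i, hi, rfl⟩, rfl⟩
    refine ⟨a + Pi.single i 1, ?_, ?_⟩
    · have : ∑ j, (a + Pi.single i 1 : ι → ℕ) j * w j = ∑ j, a j * w j + w i := by
        simp [add_mul, Finset.sum_add_distrib, Pi.single_apply]
      rw [this, add_mul, one_mul]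
      exact add_le_add ha hi
    · simp only [Pi.add_apply, pow_add, Finset.prod_mul_distrib]
      congr 1
      rw [Finset.prod_eq_single i]
      · simp
      · intro b _ hb; simp [hb]
      · simp

/-- If on `X` the powers `x j ^ e j` of the coordinate functions are combinations of monomials of
lower weight, then `X` has at most `∏ e j` points. -/
theorem card_le_prod_of_pow_mem_span {F ι : Type*} [Field F] [Fintype F] [Fintype ι]
    [DecidableEq ι] (X : Finset (ι → F)) (e w : ι → ℕ) (M : ℕ) (hM : ∀ j, e j * w j = M)
    (hx : ∀ j, (fun v : X => v.1 j) ^ e j ∈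
      Submodule.span F {y | ∃ a : ι → ℕ, ∑ j, a j * w j < M ∧
        y = ∏ j, (fun v : X => v.1 j) ^ a j}) :
    X.card ≤ ∏ j, e j := by
  classical
  set x : ι → (X → F) := fun j v => v.1 j with hxdef
  have key := prod_pow_mem_span_reduced x e w M hM hx
  have htop : Submodule.span F
      (Set.range fun b : (∀ j, Fin (e j)) => ∏ j, x j ^ (b j : ℕ)) = ⊤ := by
    rw [eq_top_iff]
    intro g _
    -- Over a finite field every function is a polynomial, so the monomials span all functions on
    -- `X`, a space of dimension `X.card`.
    have hmem : (fun v : ι → F => if h : v ∈ X then g ⟨v, h⟩ else 0) ∈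
        (MvPolynomial.restrictDegree ι F (Fintype.card F - 1)).map (MvPolynomial.evalₗ F ι) := by
      rw [MvPolynomial.map_restrict_dom_evalₗ]; trivial
    obtain ⟨P, -, hP⟩ := hmem
    have hg : g = ∑ a ∈ P.support, P.coeff a • ∏ j, x j ^ a j := by
      funext v
      have := congrFun hP v.1
      rw [MvPolynomial.evalₗ_apply, MvPolynomial.eval_eq'] at this
      simp only [v.2, dite_true] at this
      rw [← this]
      simp [hxdef, Finset.sum_apply]
    rw [hg]
    exact Submodule.sum_mem _ fun a _ => Submodule.smul_mem _ _ (key a)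
  have h1 := finrank_range_le_card (R := F) fun b : (∀ j, Fin (e j)) => ∏ j, x j ^ (b j : ℕ)
  rw [Set.finrank, htop, finrank_top, Module.finrank_fintype_fun_eq_card] at h1
  simpa using h1

/-! ### Evasive sets over a finite field -/

open Polynomial in
/-- A set of points with last coordinate `1` on which the `k` power sums `∑ j, α j ^ i * v j ^ 2 ^ j`
are constant meets every linear subspace of dimension at most `k + 1` in boundedly many points. -/
theorem card_le_of_powerSum_const {F : Type*} [Field F] [Fintype F] {D k : ℕ}
    (X : Finset (Fin (D + 1) → F)) (hlast : ∀ v ∈ X, v (Fin.last D) = 1)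
    (α : Fin (D + 1) → F) (hα : Function.Injective α) (b : ℕ → F)
    (hb : ∀ i < k, ∀ v ∈ X, ∑ j, α j ^ i * v j ^ 2 ^ (j : ℕ) = b i)
    (hdim : Module.finrank F (Submodule.span F (X : Set (Fin (D + 1) → F))) ≤ k + 1) :
    X.card ≤ ∏ j : Fin (D + 1), 2 ^ (j : ℕ) := by
  classical
  rcases X.eq_empty_or_nonempty with rfl | ⟨v₀, hv₀⟩
  · simp
  set y : Fin (D + 1) → (X → F) := fun j v => v.1 j with hy
  have ylast : y (Fin.last D) = 1 := by
    funext v; exact hlast _ v.2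
  -- These weights give every `y j ^ 2 ^ j` the same weight `2 ^ D`, and later coordinates at most
  -- half the weight of earlier ones.
  set w : Fin (D + 1) → ℕ := fun j => 2 ^ (D - (j : ℕ)) with hw
  have hM : ∀ j : Fin (D + 1), 2 ^ (j : ℕ) * w j = 2 ^ D := by
    intro j
    rw [hw, ← pow_add]
    congr 1
    have := j.2
    omega
  set G := Submodule.span F {z | ∃ a : Fin (D + 1) → ℕ, ∑ j, a j * w j < 2 ^ D ∧
        z = ∏ j, y j ^ a j} with hG
  refine card_le_prod_of_pow_mem_span X _ w (2 ^ D) hM ?_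
  change ∀ j, y j ^ 2 ^ (j : ℕ) ∈ G
  have hone : (1 : X → F) ∈ G := Submodule.subset_span ⟨0, by simp, by simp⟩
  -- The pivots: coordinates not expressible on `X` through later ones. They are independent, so
  -- there are at most `k + 1`.
  set J : Finset (Fin (D + 1)) :=
    Finset.univ.filter fun j => y j ∉ Submodule.span F (y '' {i | j < i}) with hJ
  have hnon : ∀ j, j ∉ J → y j ^ 2 ^ (j : ℕ) ∈ G := by
    intro j hj
    have hj' : y j ∈ Submodule.span F (y '' {i | j < i}) := by
      simpa [hJ] using hj
    have hjD : (j : ℕ) < D := by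
      by_contra hcon
      have : {i | j < i} = (∅ : Set (Fin (D + 1))) := by
        ext i
        have := i.2
        simp only [Set.mem_ofPred_eq, Set.mem_empty_iff_false, iff_false, Fin.lt_def]
        omega
      rw [this] at hj'
      have hjl : j = Fin.last D := by
        apply Fin.ext
        have := j.2
        simp only [Fin.val_last]
        omega
      simp only [Set.image_empty, Submodule.span_empty, Submodule.mem_bot] at hj'
      rw [hjl, ylast] at hj'
      exact one_ne_zero (congrFun hj' ⟨v₀, hv₀⟩)
    -- A non-pivot is a combination of coordinates of at most half its weight, so its `2 ^ j`-th
    -- power has weight at most `2 ^ (D - 1)`.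
    have h1 := pow_mem_span_weight y w (2 ^ (D - (j : ℕ) - 1)) (y j)
      (Submodule.span_mono (Set.image_mono fun i (hi : j < i) =>
        (Nat.pow_le_pow_right (by norm_num)
          (by have : (j : ℕ) < i := hi
              omega) : (2 : ℕ) ^ (D - (i : ℕ)) ≤ _)) hj') (2 ^ (j : ℕ))
    refine Submodule.span_mono ?_ h1
    rintro z ⟨a, ha, rfl⟩
    refine ⟨a, lt_of_le_of_lt ha ?_, rfl⟩
    rw [← pow_add]
    exact Nat.pow_lt_pow_right (by norm_num) (by omega)
  have hind : LinearIndependent F (fun j : J => y j) := by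
    rw [Fintype.linearIndependent_iff]
    by_contra! hcon
    obtain ⟨g, hg, j₀, hj₀⟩ := hcon
    have hne : (Finset.univ.filter fun j : J => g j ≠ 0).Nonempty := ⟨j₀, by simp [hj₀]⟩
    set j := (Finset.univ.filter fun j : J => g j ≠ 0).min' hne with hjdef
    have hgj : g j ≠ 0 := by
      have := Finset.min'_mem _ hne
      exact (Finset.mem_filter.mp this).2
    have hmin : ∀ i : J, g i ≠ 0 → j ≤ i := fun i hi =>
      Finset.min'_le _ _ (by simp [hi])
    have hpiv := (Finset.mem_filter.mp j.2).2
    apply hpiv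
    have hsum : g j • y j = -∑ i ∈ Finset.univ.erase j, g i • y i := by
      rw [← Finset.add_sum_erase _ _ (Finset.mem_univ j)] at hg
      exact eq_neg_of_add_eq_zero_left hg
    have : y j = (g j)⁻¹ • -∑ i ∈ Finset.univ.erase j, g i • y i := by
      rw [← hsum, smul_smul, inv_mul_cancel₀ hgj, one_smul]
    rw [this]
    refine Submodule.smul_mem _ _ (Submodule.neg_mem _ (Submodule.sum_mem _ fun i hi => ?_))
    by_cases hgi : g i = 0
    · simp [hgi]
    · refine Submodule.smul_mem _ _ (Submodule.subset_span ⟨i, ?_, rfl⟩)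
      have hne : i ≠ j := (Finset.mem_erase.mp hi).1
      exact lt_of_le_of_ne (hmin i hgi) (fun h => hne h.symm)
  -- Row rank equals column rank: the coordinate functions span a space of the same dimension as the
  -- points.
  have hcard : J.card ≤ k + 1 := by
    have h1 : J.card = Module.finrank F (Submodule.span F (Set.range fun j : J => y j)) := by
      rw [finrank_span_eq_card hind, Fintype.card_coe]
    have h2 : Submodule.span F (Set.range fun j : J => y j) ≤ Submodule.span F (Set.range y) :=
      Submodule.span_mono (by rintro _ ⟨j, rfl⟩; exact ⟨j, rfl⟩)
    let A : Matrix X (Fin (D + 1)) F := fun v j => v.1 j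
    have h3 := A.rank_eq_finrank_span_cols
    have h4 := A.rank_eq_finrank_span_row
    have h5 : Set.range A.col = Set.range y := rfl
    have h6 : Set.range A.row = (X : Set (Fin (D + 1) → F)) := by
      ext v
      simp only [Set.mem_range, Finset.mem_coe]
      exact ⟨fun ⟨x, hx⟩ => hx ▸ x.2, fun h => ⟨⟨v, h⟩, rfl⟩⟩
    rw [h5] at h3
    rw [h6] at h4
    rw [h1]
    exact (Submodule.finrank_mono h2).trans (by rw [← h3, h4]; exact hdim)
  have hlastJ : Fin.last D ∈ J := by
    by_contra hcon
    have hj' : y (Fin.last D) ∈ Submodule.span F (y '' {i | Fin.last D < i}) := by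
      simpa [hJ] using hcon
    have : {i | Fin.last D < i} = (∅ : Set (Fin (D + 1))) := by
      ext i; simp [Fin.le_last]
    rw [this, ylast] at hj'
    simp only [Set.image_empty, Submodule.span_empty, Submodule.mem_bot] at hj'
    exact one_ne_zero (congrFun hj' ⟨v₀, hv₀⟩)
  intro j
  by_cases hjJ : j ∉ J
  · exact hnon j hjJ
  push Not at hjJ
  by_cases hjl : j = Fin.last D
  · rw [hjl, ylast, one_pow]; exact hone
  -- Combining the power sums with the coefficients of `q` cancels all pivots except `j` and the
  -- last, whose coordinate is the constant `1`. At most `k - 1` roots are needed, so `k` power sums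
  -- suffice.
  set q : F[X] := ∏ i ∈ (J.erase (Fin.last D)).erase j, (Polynomial.X - C (α i)) with hq
  have hqdeg : q.natDegree < k := by
    rw [hq, natDegree_prod_of_monic _ _ fun i _ => monic_X_sub_C _]
    simp only [natDegree_X_sub_C, Finset.sum_const, smul_eq_mul, mul_one]
    rw [Finset.card_erase_of_mem (Finset.mem_erase.mpr ⟨hjl, hjJ⟩),
      Finset.card_erase_of_mem hlastJ]
    have : 1 < J.card := Finset.one_lt_card.mpr ⟨j, hjJ, _, hlastJ, hjl⟩
    omega
  have hqj : q.eval (α j) ≠ 0 := by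
    rw [hq, eval_prod, Finset.prod_ne_zero_iff]
    intro i hi
    simp only [eval_sub, eval_X, eval_C]
    exact sub_ne_zero.mpr fun h => (Finset.mem_erase.mp hi).1 (hα h).symm
  have hconst : ∑ i, q.eval (α i) • y i ^ 2 ^ (i : ℕ) =
      (∑ l ∈ Finset.range k, q.coeff l * b l) • (1 : X → F) := by
    funext v
    simp only [Finset.sum_apply, Pi.smul_apply, Pi.pow_apply, smul_eq_mul, Pi.one_apply, mul_one]
    calc ∑ i, q.eval (α i) * y i v ^ 2 ^ (i : ℕ)
        = ∑ i, ∑ l ∈ Finset.range k, q.coeff l * (α i ^ l * v.1 i ^ 2 ^ (i : ℕ)) := by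
          refine Finset.sum_congr rfl fun i _ => ?_
          rw [eval_eq_sum_range' hqdeg, Finset.sum_mul]
          refine Finset.sum_congr rfl fun l _ => ?_
          rw [mul_assoc]
      _ = _ := by
          rw [Finset.sum_comm]
          refine Finset.sum_congr rfl fun l hl => ?_
          rw [← Finset.mul_sum, hb l (Finset.mem_range.mp hl) v.1 v.2]
  have hrest : ∀ i ≠ j, q.eval (α i) • y i ^ 2 ^ (i : ℕ) ∈ G := by
    intro i hij
    by_cases hiJ : i ∈ J
    · by_cases hil : i = Fin.last D
      · rw [hil, ylast, one_pow]; exact Submodule.smul_mem _ _ hone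
      · have : q.eval (α i) = 0 := by
          rw [hq, eval_prod]
          exact Finset.prod_eq_zero (Finset.mem_erase.mpr ⟨hij, Finset.mem_erase.mpr ⟨hil, hiJ⟩⟩)
            (by simp)
        rw [this, zero_smul]; exact Submodule.zero_mem _
    · exact Submodule.smul_mem _ _ (hnon i hiJ)
  rw [← Finset.add_sum_erase _ _ (Finset.mem_univ j)] at hconst
  have hmem : q.eval (α j) • y j ^ 2 ^ (j : ℕ) ∈ G := by
    rw [eq_sub_of_add_eq hconst]
    exact Submodule.sub_mem _ (Submodule.smul_mem _ _ hone)
      (Submodule.sum_mem _ fun i hi => hrest i (Finset.mem_erase.mp hi).1)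
  exact (Submodule.smul_mem_iff _ hqj).mp hmem

/-! ### Lifting to small integer normals -/

/-- Integer vectors that are linearly independent modulo a prime are linearly independent
over `ℚ`. -/
theorem linearIndependent_rat_of_zmod {p : ℕ} [Fact p.Prime] {ι κ : Type*} [Fintype ι]
    (u : ι → κ → ℤ) (h : LinearIndependent (ZMod p) fun i j => ((u i j : ℤ) : ZMod p)) :
    LinearIndependent ℚ fun i j => (u i j : ℚ) := by
  rw [← LinearIndependent.iff_fractionRing ℤ ℚ, Fintype.linearIndependent_iff]
  intro g hg
  have hg' : ∀ j, ∑ i, g i * u i j = 0 := by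
    intro j
    have := congrFun hg j
    simp only [Finset.sum_apply, Pi.smul_apply, Pi.zero_apply] at this
    simp only [zsmul_eq_mul] at this
    exact_mod_cast this
  rw [Fintype.linearIndependent_iff] at h
  have hp : (p : ℤ) ≠ 0 := by exact_mod_cast (Fact.out : p.Prime).ne_zero
  -- Descent: an integer relation vanishes modulo `p`, and dividing it by `p` gives another
  -- relation.
  have key : ∀ N : ℕ, ∀ g : ι → ℤ, (∀ j, ∑ i, g i * u i j = 0) → ∀ i, (p : ℤ) ^ N ∣ g i := by
    intro N
    induction N with
    | zero => simp
    | succ N ih =>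
      intro g hg
      have hdvd : ∀ i, (p : ℤ) ∣ g i := by
        intro i
        rw [← ZMod.intCast_zmod_eq_zero_iff_dvd]
        refine h (fun i => (g i : ZMod p)) ?_ i
        funext j
        have := congrArg (fun z : ℤ => (z : ZMod p)) (hg j)
        simpa [Finset.sum_apply] using this
      choose g' hg' using hdvd
      intro i
      rw [hg' i, pow_succ']
      refine mul_dvd_mul_left _ (ih g' (fun j => ?_) i)
      have h0 := hg j
      simp_rw [hg', mul_assoc] at h0
      rw [← Finset.mul_sum] at h0
      exact (mul_eq_zero.mp h0).resolve_left hp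
  intro i
  refine Int.eq_zero_of_abs_lt_dvd (key (g i).natAbs g hg' i) ?_
  have h2 : (g i).natAbs < p ^ (g i).natAbs := Nat.lt_pow_self (Fact.out : p.Prime).one_lt
  rw [Int.abs_eq_natAbs]
  exact_mod_cast h2

/-- Every vector over `ZMod p` has a nonzero multiple with a small integer representative. -/
theorem exists_small_representative {d p q : ℕ} [Fact p.Prime] (hd : 1 ≤ d) (h1 : q ^ d < p)
    (h2 : p ≤ 2 * q ^ d) (v : Fin d → ZMod p) :
    ∃ (c : ZMod p) (u : Fin d → ℤ), c ≠ 0 ∧ (∀ i, (u i : ZMod p) = c * v i) ∧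
      ∀ i, |u i| ≤ 2 * (q : ℤ) ^ (d - 1) := by
  classical
  -- Cells of side `K` cut `(ZMod p) ^ d` into at most `q ^ d < p` boxes. Two of the `p` multiples
  -- of `v` share a box, and their difference is small.
  set K := 2 * q ^ (d - 1) with hK
  have hp : 0 < p := (Fact.out : p.Prime).pos
  have hqK : q * K = 2 * q ^ d := by
    obtain ⟨e, rfl⟩ : ∃ e, d = e + 1 := ⟨d - 1, by omega⟩
    simp only [hK, Nat.add_sub_cancel, pow_succ]
    ring
  have hK0 : 0 < K := by
    rcases Nat.eq_zero_or_pos K with h | h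
    · rw [h] at hqK; omega
    · exact h
  let f : ZMod p → (Fin d → Fin q) := fun c i => ⟨(c * v i).val / K, by
    rw [Nat.div_lt_iff_lt_mul hK0, hqK]
    exact lt_of_lt_of_le (ZMod.val_lt _) h2⟩
  obtain ⟨c, c', hne, hf⟩ := Fintype.exists_ne_map_eq_of_card_lt f (by simpa [ZMod.card] using h1)
  refine ⟨c - c', fun i => ((c * v i).val : ℤ) - ((c' * v i).val : ℤ), sub_ne_zero.mpr hne, ?_, ?_⟩
  · intro i
    push_cast
    rw [ZMod.natCast_zmod_val, ZMod.natCast_zmod_val, sub_mul]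
  · intro i
    have hi : (c * v i).val / K = (c' * v i).val / K := congrArg Fin.val (congrFun hf i)
    have e1 := Nat.div_add_mod (c * v i).val K
    have e2 := Nat.div_add_mod (c' * v i).val K
    have l1 := Nat.mod_lt (c * v i).val hK0
    have l2 := Nat.mod_lt (c' * v i).val hK0
    rw [hi] at e1
    have hKz : 2 * (q : ℤ) ^ (d - 1) = (K : ℤ) := by simp [hK]
    rw [hKz]
    change |((c * v i).val : ℤ) - ((c' * v i).val : ℤ)| ≤ K
    rw [abs_le]
    constructor <;> omega

/-- A set of `p ^ s` points with last coordinate `1` on which the power sums are constant. -/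
theorem exists_powerSum_const {p D k s : ℕ} [Fact p.Prime] (hks : k + s = D)
    (α : Fin (D + 1) → ZMod p) :
    ∃ (X : Finset (Fin (D + 1) → ZMod p)) (b : ℕ → ZMod p), p ^ s ≤ X.card ∧
      (∀ v ∈ X, v (Fin.last D) = 1) ∧
      ∀ i < k, ∀ v ∈ X, ∑ j, α j ^ i * v j ^ 2 ^ (j : ℕ) = b i := by
  classical
  let E : (Fin D → ZMod p) → (Fin (D + 1) → ZMod p) := fun v => Fin.snoc (α := fun _ => ZMod p) v 1
  have hE : Function.Injective E := by
    intro v v' h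
    funext i
    have := congrFun h i.castSucc
    simpa [E] using this
  let f : (Fin (D + 1) → ZMod p) → (Fin k → ZMod p) :=
    fun v i => ∑ j, α j ^ (i : ℕ) * v j ^ 2 ^ (j : ℕ)
  -- There are `p ^ D` vectors and `p ^ k` possible values, so some fibre has at least `p ^ s`
  -- elements.
  obtain ⟨b, -, hb⟩ := Finset.exists_le_card_fiber_of_mul_le_card_of_maps_to
    (s := Finset.univ.image E) (t := Finset.univ) (f := f) (n := p ^ s)
    (fun _ _ => Finset.mem_univ _) Finset.univ_nonempty (by
      rw [Finset.card_image_of_injective _ hE]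
      simp [ZMod.card, ← pow_add, hks])
  refine ⟨_, fun i => if h : i < k then b ⟨i, h⟩ else 0, hb, ?_, ?_⟩
  · intro v hv
    obtain ⟨v', -, rfl⟩ := Finset.mem_image.mp (Finset.mem_filter.mp hv).1
    simp [E]
  · intro i hi v hv
    have := congrFun (Finset.mem_filter.mp hv).2 ⟨i, hi⟩
    simp only [hi, dite_true]
    exact this

/-- Small integer normal vectors, boundedly many in each rational subspace of codimension `s`. -/
theorem exists_evasive_lattice_set {d s q : ℕ} (hs : s + 1 ≤ d) (hq : d ≤ q) :
    ∃ N : Finset (Fin d → ℤ), N.card = q ^ (d * s) ∧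
      (∀ u ∈ N, u ≠ 0) ∧
      (∀ u ∈ N, ∀ i, |u i| ≤ 2 * (q : ℤ) ^ (d - 1)) ∧
      (∀ u ∈ N, ∀ u' ∈ N, (∀ i j, u i * u' j = u j * u' i) → u = u') ∧
      ∀ w : Fin s → Fin d → ℚ, LinearIndependent ℚ w → ∀ T ⊆ N,
        (∀ u ∈ T, ∀ i, ∑ j, w i j * u j = 0) → T.card ≤ ∏ j : Fin d, 2 ^ (j : ℕ) := by
  classical
  obtain ⟨D, rfl⟩ : ∃ D, d = D + 1 := ⟨d - 1, by omega⟩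
  obtain ⟨p, hp, hp1, hp2⟩ := Nat.exists_prime_lt_and_le_two_mul (q ^ (D + 1))
    (pow_ne_zero _ (by omega))
  have : Fact p.Prime := ⟨hp⟩
  -- Makes the residues `0, …, D` distinct; this is where `d ≤ q` enters.
  have hpD : D + 1 < p := lt_of_le_of_lt (hq.trans (Nat.le_self_pow (by omega) q)) hp1
  let α : Fin (D + 1) → ZMod p := fun j => ((j : ℕ) : ZMod p)
  have hα : Function.Injective α := by
    intro i j hij
    have := congrArg ZMod.val hij
    simp only [α] at this
    rw [ZMod.val_cast_of_lt (by omega), ZMod.val_cast_of_lt (by omega)] at this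
    exact Fin.ext this
  obtain ⟨X, b, hXc, hXl, hXb⟩ := exists_powerSum_const (p := p) (D := D) (k := D - s) (s := s)
    (by omega) α
  choose c u hc hu hub using exists_small_representative (d := D + 1) (by omega) hp1 hp2
  -- The last coordinate `1` normalises `v`, so proportional lifts come from the same `v`.
  have hrec : ∀ v ∈ X, ∀ v' ∈ X, (∀ i j, u v i * u v' j = u v j * u v' i) → v = v' := by
    intro v hv v' hv' h
    funext i
    have := congrArg (fun z : ℤ => (z : ZMod p)) (h i (Fin.last D))
    push_cast at this
    rw [hu, hu, hu, hu, hXl v hv, hXl v' hv', mul_one, mul_one] at this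
    have hcc := mul_ne_zero (hc v) (hc v')
    apply mul_left_cancel₀ hcc
    linear_combination this
  have hinj : Set.InjOn u (X : Set (Fin (D + 1) → ZMod p)) := by
    intro v hv v' hv' h
    exact hrec v hv v' hv' fun i j => by rw [h]; ring
  have hle : q ^ ((D + 1) * s) ≤ (X.image u).card := by
    rw [Finset.card_image_of_injOn hinj, pow_mul]
    exact (Nat.pow_le_pow_left hp1.le s).trans hXc
  obtain ⟨N, hN, hNc⟩ := Finset.exists_subset_card_eq hle
  have hN' : ∀ z ∈ N, ∃ v ∈ X, u v = z := fun z hz => Finset.mem_image.mp (hN hz)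
  refine ⟨N, hNc, ?_, ?_, ?_, ?_⟩
  · intro z hz h0
    obtain ⟨v, hv, rfl⟩ := hN' z hz
    have := hu v (Fin.last D)
    rw [h0, hXl v hv] at this
    simp only [Pi.zero_apply, Int.cast_zero, mul_one] at this
    exact hc v this.symm
  · intro z hz
    obtain ⟨v, hv, rfl⟩ := hN' z hz
    exact hub v
  · intro z hz z' hz' h
    obtain ⟨v, hv, rfl⟩ := hN' z hz
    obtain ⟨v', hv', rfl⟩ := hN' z' hz'
    rw [hrec v hv v' hv' h]
  · intro w hw T hT hTw
    set Y := X.filter fun v => u v ∈ T with hY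
    have hYX : ∀ v ∈ Y, v ∈ X := fun v hv => (Finset.mem_filter.mp hv).1
    have hTY : T.card ≤ Y.card := by
      have : T ⊆ Y.image u := by
        intro z hz
        obtain ⟨v, hv, rfl⟩ := hN' z (hT hz)
        exact Finset.mem_image_of_mem _ (Finset.mem_filter.mpr ⟨hv, hz⟩)
      exact (Finset.card_le_card this).trans Finset.card_image_le
    refine hTY.trans (card_le_of_powerSum_const (k := D - s) Y (fun v hv => hXl v (hYX v hv)) α hα b
      (fun i hi v hv => hXb i hi v (hYX v hv)) ?_)
    -- A basis of the span modulo `p` lifts to rationally independent vectors in the kernel of `w`,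
    -- of dimension `D + 1 - s = k + 1`.
    obtain ⟨t, htY, htspan, htind⟩ := exists_linearIndependent (ZMod p)
      (Y : Set (Fin (D + 1) → ZMod p))
    have : Fintype t := (Y.finite_toSet.subset htY).fintype
    rw [← htspan, ← Subtype.range_coe (s := t), finrank_span_eq_card htind]
    have hind2 : LinearIndependent (ZMod p) fun (v : t) j => ((u v.1 j : ℤ) : ZMod p) := by
      have he : (fun (v : t) j => ((u v.1 j : ℤ) : ZMod p)) =
          (fun v : t => Units.mk0 (c v.1) (hc v.1)) • (Subtype.val : t → Fin (D + 1) → ZMod p) := by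
        funext v j
        simp [hu, Units.smul_def]
      rw [he]
      exact htind.units_smul _
    have hQ := linearIndependent_rat_of_zmod (fun v : t => u v.1) hind2
    let A : (Fin (D + 1) → ℚ) →ₗ[ℚ] (Fin s → ℚ) := Matrix.mulVecLin (Matrix.of w)
    have hker : ∀ v : t, (fun j => (u v.1 j : ℚ)) ∈ LinearMap.ker A := by
      intro v
      rw [LinearMap.mem_ker]
      funext i
      exact hTw _ (Finset.mem_filter.mp (htY v.2)).2 i
    have hcard : Fintype.card t ≤ Module.finrank ℚ (LinearMap.ker A) := by
      rw [← finrank_span_eq_card hQ]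
      apply Submodule.finrank_mono
      rw [Submodule.span_le]
      rintro _ ⟨v, rfl⟩
      exact hker v
    have hrk : Module.finrank ℚ (LinearMap.range A) = s := by
      have h1 : Module.finrank ℚ (LinearMap.range A) = (Matrix.of w).rank := rfl
      rw [h1, Matrix.rank_eq_finrank_span_row]
      change Module.finrank ℚ (Submodule.span ℚ (Set.range w)) = s
      rw [finrank_span_eq_card hw, Fintype.card_fin]
    have := A.finrank_range_add_finrank_ker
    rw [hrk, Module.finrank_fin_fun] at this
    refine hcard.trans ?_
    omega

/-! ### Hyperplanes with integer normals -/

/-- The vector of `ℝ^d` with the given integer coordinates. -/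
noncomputable def latticeVec {d : ℕ} (x : Fin d → ℤ) : EuclideanSpace ℝ (Fin d) :=
  WithLp.toLp 2 fun i => (x i : ℝ)

theorem latticeVec_injective {d : ℕ} : Function.Injective (latticeVec (d := d)) := by
  intro x y h
  funext i
  have := congrArg (fun v : EuclideanSpace ℝ (Fin d) => v i) h
  simpa [latticeVec] using this

theorem inner_latticeVec {d : ℕ} (x y : Fin d → ℤ) :
    inner ℝ (latticeVec x) (latticeVec y) = ((∑ i, x i * y i : ℤ) : ℝ) := by
  simp [latticeVec, PiLp.inner_apply, mul_comm]

theorem latticeVec_sub {d : ℕ} (x y : Fin d → ℤ) :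
    latticeVec x - latticeVec y = latticeVec (x - y) := by
  ext i
  simp [latticeVec]

/-- The hyperplane through `x` with normal vector `c`. -/
noncomputable def hyperplaneThrough {d : ℕ} (x c : EuclideanSpace ℝ (Fin d)) :
    AffineSubspace ℝ (EuclideanSpace ℝ (Fin d)) :=
  AffineSubspace.mk' x (Submodule.span ℝ {c})ᗮ

theorem mem_hyperplaneThrough {d : ℕ} {x c y : EuclideanSpace ℝ (Fin d)} :
    y ∈ hyperplaneThrough x c ↔ inner ℝ c (y - x) = 0 := by
  rw [hyperplaneThrough, AffineSubspace.mem_mk', vsub_eq_sub,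
    Submodule.mem_orthogonal_singleton_iff_inner_right]

theorem latticeVec_mem_hyperplaneThrough {d : ℕ} {x u y : Fin d → ℤ} :
    latticeVec y ∈ hyperplaneThrough (latticeVec x) (latticeVec u) ↔
      ∑ i, u i * (y i - x i) = 0 := by
  rw [mem_hyperplaneThrough, latticeVec_sub, inner_latticeVec]
  exact_mod_cast Iff.rfl

/-- Rebases hyperplanes at a common point, so that they differ only in their normals. -/
theorem hyperplaneThrough_eq_of_mem {d : ℕ} {x c y : EuclideanSpace ℝ (Fin d)}
    (h : y ∈ hyperplaneThrough x c) : hyperplaneThrough x c = hyperplaneThrough y c := by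
  rw [mem_hyperplaneThrough] at h
  ext z
  rw [mem_hyperplaneThrough, mem_hyperplaneThrough, ← sub_sub_sub_cancel_right z y x,
    inner_sub_right _ (z - x), h, sub_zero]

theorem isHyperplane_hyperplaneThrough {d : ℕ} (x : EuclideanSpace ℝ (Fin d))
    {c : EuclideanSpace ℝ (Fin d)} (hc : c ≠ 0) : IsHyperplane (hyperplaneThrough x c) := by
  refine ⟨⟨x, AffineSubspace.self_mem_mk' _ _⟩, ?_⟩
  rw [hyperplaneThrough, AffineSubspace.direction_mk']
  have h1 := Submodule.finrank_add_finrank_orthogonal (Submodule.span ℝ {c})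
  rw [finrank_span_singleton hc, finrank_euclideanSpace_fin] at h1
  omega

/-- Hyperplanes through a point with integer normals determine the normals up to a multiple. -/
theorem cross_eq_of_hyperplaneThrough_eq {d : ℕ} {x y : EuclideanSpace ℝ (Fin d)} {u v : Fin d → ℤ}
    (h : hyperplaneThrough x (latticeVec u) = hyperplaneThrough y (latticeVec v)) (i j : Fin d) :
    u i * v j = u j * v i := by
  have hdir := congrArg AffineSubspace.direction h
  rw [hyperplaneThrough, hyperplaneThrough, AffineSubspace.direction_mk',
    AffineSubspace.direction_mk'] at hdir
  have hspan : Submodule.span ℝ {latticeVec u} = Submodule.span ℝ {latticeVec v} := by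
    rw [← Submodule.orthogonal_orthogonal (Submodule.span ℝ {latticeVec u}), hdir,
      Submodule.orthogonal_orthogonal]
  have hmem : latticeVec u ∈ Submodule.span ℝ {latticeVec v} := by
    rw [← hspan]; exact Submodule.mem_span_singleton_self _
  obtain ⟨r, hr⟩ := Submodule.mem_span_singleton.mp hmem
  have hri : ∀ i, r * (v i : ℝ) = u i := fun i => by
    have := congrArg (fun w : EuclideanSpace ℝ (Fin d) => w i) hr
    simpa [latticeVec] using this
  have : (u i : ℝ) * v j = u j * v i := by
    rw [← hri i, ← hri j]; ring
  exact_mod_cast this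

/-! ### Counting incidences, padding and the trivial configuration -/

theorem le_incidences {d : ℕ} {ι : Type*} (I : Finset ι) (P : Finset (EuclideanSpace ℝ (Fin d)))
    (H : Finset (AffineSubspace ℝ (EuclideanSpace ℝ (Fin d))))
    (f : ι → EuclideanSpace ℝ (Fin d) × AffineSubspace ℝ (EuclideanSpace ℝ (Fin d)))
    (hf : Set.InjOn f I) (h : ∀ i ∈ I, (f i).1 ∈ P ∧ (f i).2 ∈ H ∧ (f i).1 ∈ (f i).2) :
    I.card ≤ incidences P H := by
  have hfin : {q : EuclideanSpace ℝ (Fin d) × AffineSubspace ℝ (EuclideanSpace ℝ (Fin d)) |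
      q.1 ∈ P ∧ q.2 ∈ H ∧ q.1 ∈ q.2}.Finite :=
    (P ×ˢ H).finite_toSet.subset fun q hq => by
      rw [Finset.mem_coe, Finset.mem_product]; exact ⟨hq.1, hq.2.1⟩
  rw [← Set.ncard_coe_finset I, ← hf.ncard_image]
  refine Set.ncard_le_ncard ?_ hfin
  rintro _ ⟨i, hi, rfl⟩
  exact h i hi

theorem incidences_mono_right {d : ℕ} (P : Finset (EuclideanSpace ℝ (Fin d)))
    {H H' : Finset (AffineSubspace ℝ (EuclideanSpace ℝ (Fin d)))} (h : H ⊆ H') :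
    incidences P H ≤ incidences P H' := by
  have hfin : {q : EuclideanSpace ℝ (Fin d) × AffineSubspace ℝ (EuclideanSpace ℝ (Fin d)) |
      q.1 ∈ P ∧ q.2 ∈ H' ∧ q.1 ∈ q.2}.Finite :=
    (P ×ˢ H').finite_toSet.subset fun q hq => by
      rw [Finset.mem_coe, Finset.mem_product]; exact ⟨hq.1, hq.2.1⟩
  exact Set.ncard_le_ncard (fun q hq => ⟨hq.1, h hq.2.1, hq.2.2⟩) hfin

/-- There are infinitely many hyperplanes that avoid a given finite set of points. -/
theorem infinite_hyperplanes_avoiding {d : ℕ} (hd : 1 ≤ d)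
    (P : Finset (EuclideanSpace ℝ (Fin d))) :
    {h : AffineSubspace ℝ (EuclideanSpace ℝ (Fin d)) |
      IsHyperplane h ∧ ∀ p ∈ P, p ∉ h}.Infinite := by
  classical
  let c : EuclideanSpace ℝ (Fin d) := EuclideanSpace.single ⟨0, hd⟩ 1
  have hc : c ≠ 0 := by simp [c]
  have hcc : inner ℝ c c = (1 : ℝ) := by simp [c]
  -- Parallel hyperplanes indexed by their level; only finitely many levels are taken on `P`.
  let h : ℝ → AffineSubspace ℝ (EuclideanSpace ℝ (Fin d)) := fun r => hyperplaneThrough (r • c) c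
  have hmem : ∀ r y, y ∈ h r ↔ inner ℝ c y = r := by
    intro r y
    rw [mem_hyperplaneThrough, inner_sub_right, inner_smul_right, hcc, mul_one, sub_eq_zero]
  have hinj : Function.Injective h := by
    intro r r' hr
    have : r • c ∈ h r' := by
      rw [← hr, hmem, inner_smul_right, hcc, mul_one]
    rwa [hmem, inner_smul_right, hcc, mul_one] at this
  have hS : (Set.univ \ ((P.image fun p => inner ℝ c p : Finset ℝ) : Set ℝ)).Infinite :=
    Set.infinite_univ.sdiff (Finset.finite_toSet _)
  refine (hS.image hinj.injOn).mono ?_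
  rintro _ ⟨r, ⟨-, hr⟩, rfl⟩
  refine ⟨isHyperplane_hyperplaneThrough _ hc, fun p hp hpr => hr ?_⟩
  rw [hmem] at hpr
  exact Finset.mem_coe.mpr (Finset.mem_image.mpr ⟨p, hp, hpr⟩)

/-- A family of hyperplanes may be enlarged by hyperplanes that avoid all points. -/
theorem exists_padding {d n s t : ℕ} (hd : 1 ≤ d) (P : Finset (EuclideanSpace ℝ (Fin d)))
    (H : Finset (AffineSubspace ℝ (EuclideanSpace ℝ (Fin d)))) (hn : H.card ≤ n)
    (hH : ∀ h ∈ H, IsHyperplane h) (hK : ¬ ContainsK (s + 1) t P H) :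
    ∃ H' : Finset (AffineSubspace ℝ (EuclideanSpace ℝ (Fin d))), H'.card = n ∧
      (∀ h ∈ H', IsHyperplane h) ∧ ¬ ContainsK (s + 1) t P H' ∧
      incidences P H ≤ incidences P H' := by
  classical
  obtain ⟨A, hA, hAc⟩ := ((infinite_hyperplanes_avoiding hd P).sdiff
    H.finite_toSet).exists_subset_card_eq (n - H.card)
  have hdisj : Disjoint H A := by
    rw [Finset.disjoint_right]
    intro h hh hhH
    exact (hA hh).2 hhH
  refine ⟨H ∪ A, ?_, ?_, ?_, incidences_mono_right P Finset.subset_union_left⟩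
  · rw [Finset.card_union_of_disjoint hdisj, hAc]; omega
  · intro h hh
    rcases Finset.mem_union.mp hh with hh | hh
    · exact hH h hh
    · exact (hA hh).1.1
  · rintro ⟨S, hS, T, hT, hSc, hTc, hST⟩
    refine hK ⟨S, hS, T, ?_, hSc, hTc, hST⟩
    intro h hh
    -- A copy of `K` has at least one point, which no added hyperplane contains.
    obtain ⟨p, hp⟩ : S.Nonempty := Finset.card_pos.mp (by omega)
    rcases Finset.mem_union.mp (hT hh) with hh' | hh'
    · exact hh'
    · exact absurd (hST p hp h hh) ((hA hh').1.2 p (hS hp))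

theorem ContainsK.mono {d s t s' t' : ℕ} {P : Finset (EuclideanSpace ℝ (Fin d))}
    {H : Finset (AffineSubspace ℝ (EuclideanSpace ℝ (Fin d)))} (hs : s' ≤ s) (ht : t' ≤ t)
    (h : ContainsK s t P H) : ContainsK s' t' P H := by
  obtain ⟨S, hS, T, hT, hSc, hTc, hST⟩ := h
  obtain ⟨S', hS', hSc'⟩ := Finset.exists_subset_card_eq (hs.trans hSc.ge)
  obtain ⟨T', hT', hTc'⟩ := Finset.exists_subset_card_eq (ht.trans hTc.ge)
  exact ⟨S', hS'.trans hS, T', hT'.trans hT, hSc', hTc', fun p hp h hh =>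
    hST p (hS' hp) h (hT' hh)⟩

/-- A double star: `m` points on one hyperplane, `n` hyperplanes through one point, and no further
incidences. -/
theorem exists_double_star {d m n : ℕ} (hd : 2 ≤ d) (hm : 1 ≤ m) (hn : 1 ≤ n) :
    ∃ (P : Finset (EuclideanSpace ℝ (Fin d)))
      (H : Finset (AffineSubspace ℝ (EuclideanSpace ℝ (Fin d)))),
      P.card = m ∧ H.card = n ∧ (∀ h ∈ H, IsHyperplane h) ∧ ¬ ContainsK 2 2 P H ∧
      m + n ≤ incidences P H + 1 := by
  classical
  let i0 : Fin d := ⟨0, by omega⟩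
  let i1 : Fin d := ⟨1, by omega⟩
  have h01 : i0 ≠ i1 := by simp [i0, i1]
  -- The points lie on one coordinate axis; `h0` contains the axis and every `hp k` meets it only at
  -- the origin.
  let pt : ℕ → Fin d → ℤ := fun k => Pi.single i0 (k : ℤ)
  let nv : ℕ → Fin d → ℤ := fun k => Pi.single i0 1 + Pi.single i1 (k : ℤ)
  let n0 : Fin d → ℤ := Pi.single i1 1
  have hlv : ∀ u : Fin d → ℤ, u ≠ 0 → latticeVec u ≠ 0 := fun u hu h => hu
    (latticeVec_injective (h.trans (by ext i; simp [latticeVec])))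
  let hp : ℕ → AffineSubspace ℝ (EuclideanSpace ℝ (Fin d)) :=
    fun k => hyperplaneThrough (latticeVec (pt 0)) (latticeVec (nv k))
  let h0 : AffineSubspace ℝ (EuclideanSpace ℝ (Fin d)) :=
    hyperplaneThrough (latticeVec (pt 0)) (latticeVec n0)
  have hptinj : Function.Injective fun k => latticeVec (pt k) := by
    intro k l h
    have := congrFun (latticeVec_injective h) i0
    simpa [pt] using this
  have mem_hp : ∀ k l, latticeVec (pt l) ∈ hp k ↔ l = 0 := by
    intro k l
    rw [latticeVec_mem_hyperplaneThrough]
    have : ∑ i, nv k i * (pt l i - pt 0 i) = (l : ℤ) := by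
      rw [Finset.sum_eq_single i0]
      · simp [nv, pt, h01]
      · intro i _ hi; simp [pt, hi]
      · simp
    rw [this]; simp
  have mem_h0 : ∀ l, latticeVec (pt l) ∈ h0 := by
    intro l
    rw [latticeVec_mem_hyperplaneThrough]
    refine Finset.sum_eq_zero fun i _ => ?_
    by_cases hi : i = i0
    · subst hi; simp [n0, h01]
    · simp [pt, hi]
  have hpinj : Function.Injective hp := by
    intro k l h
    have := cross_eq_of_hyperplaneThrough_eq h i0 i1
    simp [nv, h01, h01.symm] at this
    exact this.symm
  have hne : ∀ k, hp k ≠ h0 := by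
    intro k h
    have := mem_h0 1
    rw [← h, mem_hp] at this
    omega
  refine ⟨(Finset.range m).image fun k => latticeVec (pt k),
    insert h0 ((Finset.range (n - 1)).image hp), ?_, ?_, ?_, ?_, ?_⟩
  · rw [Finset.card_image_of_injective _ hptinj, Finset.card_range]
  · rw [Finset.card_insert_of_notMem, Finset.card_image_of_injective _ hpinj, Finset.card_range]
    · omega
    · intro h
      obtain ⟨k, -, hk⟩ := Finset.mem_image.mp h
      exact hne k hk
  · intro h hh
    rcases Finset.mem_insert.mp hh with rfl | hh
    · refine isHyperplane_hyperplaneThrough _ (hlv _ fun h => ?_)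
      have := congrFun h i1
      simp [n0] at this
    · obtain ⟨k, -, rfl⟩ := Finset.mem_image.mp hh
      refine isHyperplane_hyperplaneThrough _ (hlv _ fun h => ?_)
      have := congrFun h i0
      simp [nv, h01] at this
  · rintro ⟨S, hS, T, hT, hSc, hTc, hST⟩
    obtain ⟨h, hh, hhne⟩ := Finset.exists_mem_ne (by omega : 1 < T.card) h0
    obtain ⟨p, hp', hpne⟩ := Finset.exists_mem_ne (by omega : 1 < S.card) (latticeVec (pt 0))
    obtain ⟨k, -, rfl⟩ := Finset.mem_image.mp ((Finset.mem_insert.mp (hT hh)).resolve_left hhne)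
    obtain ⟨l, -, rfl⟩ := Finset.mem_image.mp (hS hp')
    have := (mem_hp k l).mp (hST _ hp' _ hh)
    subst this
    exact hpne rfl
  · have := le_incidences ((Finset.range m).disjSum (Finset.range (n - 1)))
      ((Finset.range m).image fun k => latticeVec (pt k))
      (insert h0 ((Finset.range (n - 1)).image hp))
      (Sum.elim (fun k => (latticeVec (pt k), h0)) (fun k => (latticeVec (pt 0), hp k))) ?_ ?_
    · rw [Finset.card_disjSum, Finset.card_range, Finset.card_range] at this
      omega
    · rintro (k | k) - (l | l) - h
      · simp only [Sum.elim_inl, Prod.mk.injEq, and_true] at h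
        rw [hptinj h]
      · simp only [Sum.elim_inl, Sum.elim_inr, Prod.mk.injEq] at h
        exact absurd h.2.symm (hne l)
      · simp only [Sum.elim_inl, Sum.elim_inr, Prod.mk.injEq] at h
        exact absurd h.2 (hne k)
      · simp only [Sum.elim_inr, Prod.mk.injEq, true_and] at h
        rw [hpinj h]
    · rintro (k | k) hk
      · exact ⟨Finset.mem_image_of_mem (fun k => latticeVec (pt k)) (by simpa using hk),
          Finset.mem_insert_self _ _, mem_h0 k⟩
      · refine ⟨Finset.mem_image_of_mem (fun k => latticeVec (pt k)) (by simpa using (by omega : 0 < m)),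
          Finset.mem_insert_of_mem (Finset.mem_image_of_mem _ (by simpa using hk)), ?_⟩
        exact (mem_hp k 0).mpr rfl

/-! ### The incidence construction -/

/-- Lattice points in a box whose `(s + 1)`-tuples are affinely independent, together with
hyperplanes whose normals form an evasive set, span many incidences. -/
theorem exists_hyperplanes_of_points {d s q a n : ℕ} (hsd : s + 1 ≤ d) (hq : d ≤ q) (ha : 1 ≤ a)
    (P : Finset (Fin d → ℤ)) (hP : ∀ x ∈ P, ∀ i, 0 ≤ x i ∧ x i ≤ a)
    (hgen : ∀ f : Fin (s + 1) → Fin d → ℤ, Function.Injective f → (∀ i, f i ∈ P) →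
      LinearIndependent ℚ fun (i : Fin s) j => ((f i.succ j - f 0 j : ℤ) : ℚ))
    (hn : 5 * d * a * q ^ (d * s + d - 1) ≤ n) :
    ∃ (Q : Finset (EuclideanSpace ℝ (Fin d)))
      (H : Finset (AffineSubspace ℝ (EuclideanSpace ℝ (Fin d)))),
      Q.card = P.card ∧ H.card = n ∧ (∀ h ∈ H, IsHyperplane h) ∧
      ¬ ContainsK (s + 1) (∏ j : Fin d, 2 ^ (j : ℕ) + 1) Q H ∧
      P.card * q ^ (d * s) ≤ incidences Q H := by
  classical
  obtain ⟨N, hNc, hN0, hNb, hNpar, hNev⟩ := exists_evasive_lattice_set hsd hq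
  have hlv : ∀ u ∈ N, latticeVec u ≠ 0 := fun u hu h => hN0 u hu
    (latticeVec_injective (h.trans (by ext i; simp [latticeVec])))
  let hyp : (Fin d → ℤ) × (Fin d → ℤ) → AffineSubspace ℝ (EuclideanSpace ℝ (Fin d)) :=
    fun z => hyperplaneThrough (latticeVec z.1) (latticeVec z.2)
  set H₀ := (P ×ˢ N).image hyp with hH₀
  have hcard : H₀.card ≤ n := by
    set B : ℕ := d * (2 * q ^ (d - 1) * a) with hB
    -- The hyperplane of normal `u` and level `l`. Counting by levels in `[-B, B]` beats counting
    -- pairs of a point and a normal.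
    let lev : (Fin d → ℤ) × ℤ → AffineSubspace ℝ (EuclideanSpace ℝ (Fin d)) := fun z =>
      hyperplaneThrough (((z.2 : ℝ) / inner ℝ (latticeVec z.1) (latticeVec z.1)) • latticeVec z.1)
        (latticeVec z.1)
    have hsub : H₀ ⊆ (N ×ˢ Finset.Icc (-(B : ℤ)) B).image lev := by
      intro h hh
      obtain ⟨⟨x, u⟩, hxu, rfl⟩ := Finset.mem_image.mp hh
      obtain ⟨hx, hu⟩ := Finset.mem_product.mp hxu
      refine Finset.mem_image.mpr ⟨(u, ∑ i, u i * x i), Finset.mem_product.mpr ⟨hu, ?_⟩, ?_⟩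
      · rw [Finset.mem_Icc, ← abs_le]
        calc |∑ i, u i * x i| ≤ ∑ i, |u i * x i| := Finset.abs_sum_le_sum_abs _ _
          _ ≤ ∑ _i : Fin d, (2 * (q : ℤ) ^ (d - 1) * a) := by
            refine Finset.sum_le_sum fun i _ => ?_
            rw [abs_mul, abs_of_nonneg (hP x hx i).1]
            exact mul_le_mul (hNb u hu i) (hP x hx i).2 (hP x hx i).1 (by positivity)
          _ = B := by simp [hB]
      · refine hyperplaneThrough_eq_of_mem ?_
        rw [mem_hyperplaneThrough, inner_sub_right, inner_smul_right,
          div_mul_cancel₀ _ (inner_self_ne_zero.mpr (hlv u hu)), inner_latticeVec, sub_self]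
    have hIcc : (Finset.Icc (-(B : ℤ)) B).card = 2 * B + 1 := by
      rw [Int.card_Icc]; omega
    have hq1 : 1 ≤ q ^ (d - 1) := Nat.one_le_pow _ _ (by omega)
    calc H₀.card ≤ _ := Finset.card_le_card hsub
      _ ≤ (N ×ˢ Finset.Icc (-(B : ℤ)) B).card := Finset.card_image_le
      _ = q ^ (d * s) * (2 * B + 1) := by rw [Finset.card_product, hNc, hIcc]
      _ ≤ q ^ (d * s) * (5 * d * a * q ^ (d - 1)) := by
        refine Nat.mul_le_mul_left _ ?_
        have h1 : 1 ≤ d * a * q ^ (d - 1) :=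
          Nat.mul_pos (Nat.mul_pos (by omega) ha) hq1
        have h2 : 2 * B + 1 = 4 * (d * a * q ^ (d - 1)) + 1 := by rw [hB]; ring
        have h3 : 5 * d * a * q ^ (d - 1) = 5 * (d * a * q ^ (d - 1)) := by ring
        omega
      _ = 5 * d * a * q ^ (d * s + d - 1) := by
        rw [Nat.add_sub_assoc (by omega), pow_add]; ring
      _ ≤ n := hn
  have hhyp : ∀ h ∈ H₀, IsHyperplane h := by
    intro h hh
    obtain ⟨⟨x, u⟩, hxu, rfl⟩ := Finset.mem_image.mp hh
    exact isHyperplane_hyperplaneThrough _ (hlv u (Finset.mem_product.mp hxu).2)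
  have hK : ¬ ContainsK (s + 1) (∏ j : Fin d, 2 ^ (j : ℕ) + 1) (P.image latticeVec) H₀ := by
    rintro ⟨S, hS, T, hT, hSc, hTc, hST⟩
    have hS' : ∀ i : Fin (s + 1), ∃ x ∈ P, latticeVec x = ((S.equivFinOfCardEq hSc).symm i).1 :=
      fun i => Finset.mem_image.mp (hS ((S.equivFinOfCardEq hSc).symm i).2)
    choose f hfP hf using hS'
    have hfS : ∀ i, latticeVec (f i) ∈ S := fun i => by
      rw [hf i]; exact ((S.equivFinOfCardEq hSc).symm i).2
    have hfinj : Function.Injective f := by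
      intro i j hij
      apply (S.equivFinOfCardEq hSc).symm.injective
      apply Subtype.ext
      rw [← hf i, ← hf j, hij]
    have hT' : ∀ h ∈ T, ∃ u ∈ N, h = hyperplaneThrough (latticeVec (f 0)) (latticeVec u) := by
      intro h hh
      obtain ⟨⟨x, u⟩, hxu, rfl⟩ := Finset.mem_image.mp (hT hh)
      exact ⟨u, (Finset.mem_product.mp hxu).2,
        hyperplaneThrough_eq_of_mem (hST _ (hfS 0) _ hh)⟩
    choose! u huN hu using hT'
    have huinj : Set.InjOn u T := by
      intro h hh h' hh' e
      rw [hu h hh, hu h' hh', e]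
    -- The normals of `T` are orthogonal to the `s` independent differences `f i.succ - f 0`, hence
    -- lie in a subspace of codimension `s`.
    have := hNev _ (hgen f hfinj hfP) (T.image u)
      (fun z hz => by
        obtain ⟨h, hh, rfl⟩ := Finset.mem_image.mp hz
        exact huN h hh)
      (fun z hz i => by
        obtain ⟨h, hh, rfl⟩ := Finset.mem_image.mp hz
        have hmem := hST _ (hfS i.succ) h hh
        rw [hu h hh, latticeVec_mem_hyperplaneThrough] at hmem
        have hmem' : ∑ j, (f i.succ j - f 0 j) * u h j = 0 := by
          rw [← hmem]
          exact Finset.sum_congr rfl fun j _ => mul_comm _ _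
        exact_mod_cast hmem')
    rw [Finset.card_image_of_injOn huinj, hTc] at this
    omega
  obtain ⟨H, hHc, hHh, hHK, hHi⟩ := exists_padding (n := n) (by omega) _ H₀ hcard hhyp hK
  refine ⟨P.image latticeVec, H, Finset.card_image_of_injective _ latticeVec_injective, hHc, hHh,
    hHK, le_trans ?_ hHi⟩
  have := le_incidences (P ×ˢ N) (P.image latticeVec) H₀ (fun z => (latticeVec z.1, hyp z)) ?_ ?_
  · rwa [Finset.card_product, hNc] at this
  · rintro ⟨x, u⟩ hxu ⟨y, v⟩ hyv h
    have hu := (Finset.mem_product.mp (Finset.mem_coe.mp hxu)).2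
    have hv := (Finset.mem_product.mp (Finset.mem_coe.mp hyv)).2
    obtain ⟨h1, h2⟩ := Prod.mk.inj h
    rw [Prod.mk.injEq]
    exact ⟨latticeVec_injective h1, hNpar u hu v hv (cross_eq_of_hyperplaneThrough_eq h2)⟩
  · rintro ⟨x, u⟩ hxu
    refine ⟨Finset.mem_image_of_mem _ (Finset.mem_product.mp hxu).1,
      Finset.mem_image_of_mem _ hxu, AffineSubspace.self_mem_mk' _ _⟩

/-! ### Supplies of lattice points -/

/-- The lattice points of the box `[0, a)^d`. -/
noncomputable def latticeBox (d a : ℕ) : Finset (Fin d → ℤ) :=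
  Fintype.piFinset fun _ => Finset.Ico (0 : ℤ) a

theorem card_latticeBox (d a : ℕ) : (latticeBox d a).card = a ^ d := by
  simp [latticeBox]

theorem mem_latticeBox {d a : ℕ} {x : Fin d → ℤ} :
    x ∈ latticeBox d a ↔ ∀ i, 0 ≤ x i ∧ x i < a := by
  simp [latticeBox]

/-- A natural number that is at least and not much more than a `g`-th root. -/
theorem exists_nat_root {g k : ℕ} (hg : 1 ≤ g) (hk : 1 ≤ k) :
    ∃ a : ℕ, 1 ≤ a ∧ (a : ℝ) ≤ 2 * (k : ℝ) ^ (1 / (g : ℝ)) ∧ k ≤ a ^ g := by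
  have hk' : (1 : ℝ) ≤ k := by exact_mod_cast hk
  have h1 : 1 ≤ (k : ℝ) ^ (1 / (g : ℝ)) := Real.one_le_rpow hk' (by positivity)
  refine ⟨⌈(k : ℝ) ^ (1 / (g : ℝ))⌉₊, Nat.one_le_ceil_iff.mpr (by linarith), ?_, ?_⟩
  · have := Nat.ceil_lt_add_one (show 0 ≤ (k : ℝ) ^ (1 / (g : ℝ)) by linarith)
    linarith
  · have h2 : (k : ℝ) = ((k : ℝ) ^ (1 / (g : ℝ))) ^ g := by
      rw [← Real.rpow_natCast, ← Real.rpow_mul (by linarith), one_div_mul_cancel, Real.rpow_one]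
      have : (g : ℝ) ≠ 0 := by exact_mod_cast (by omega : g ≠ 0)
      exact this
    have h3 : (k : ℝ) ≤ ((⌈(k : ℝ) ^ (1 / (g : ℝ))⌉₊ : ℕ) : ℝ) ^ g := by
      conv_lhs => rw [h2]
      exact pow_le_pow_left₀ (by linarith) (Nat.le_ceil _) g
    exact_mod_cast h3

/-- `m` lattice points in a box of side `O(m ^ (1 / d))`. -/
theorem exists_box_points {d m : ℕ} (hd : 1 ≤ d) (hm : 1 ≤ m) :
    ∃ (a : ℕ) (P : Finset (Fin d → ℤ)), 1 ≤ a ∧ (a : ℝ) ≤ 2 * d * (m : ℝ) ^ (1 / (d : ℝ)) ∧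
      P.card = m ∧ (∀ x ∈ P, ∀ i, 0 ≤ x i ∧ x i ≤ a) ∧
      ∀ f : Fin (1 + 1) → Fin d → ℤ, Function.Injective f → (∀ i, f i ∈ P) →
        LinearIndependent ℚ fun (i : Fin 1) j => ((f i.succ j - f 0 j : ℤ) : ℚ) := by
  obtain ⟨a, ha1, ha2, ha3⟩ := exists_nat_root hd hm
  obtain ⟨P, hP, hPc⟩ := Finset.exists_subset_card_eq (ha3.trans (card_latticeBox d a).ge)
  refine ⟨a, P, ha1, ?_, hPc, ?_, ?_⟩
  · have hd' : (1 : ℝ) ≤ d := by exact_mod_cast hd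
    have h0 : 0 ≤ (m : ℝ) ^ (1 / (d : ℝ)) := by positivity
    nlinarith
  · intro x hx i
    have := mem_latticeBox.mp (hP hx) i
    exact ⟨this.1, this.2.le⟩
  · intro f hf _
    rw [linearIndependent_unique_iff]
    intro h
    have : f 1 = f 0 := by
      funext j
      have := congrFun h j
      simp only [Pi.zero_apply, Int.cast_eq_zero] at this
      exact sub_eq_zero.mp this
    exact absurd (hf this) (by decide)

/-- Three distinct points of a sphere are affinely independent. -/
theorem linearIndependent_of_sphere {d : ℕ} {r : ℤ} (f : Fin (2 + 1) → Fin d → ℤ)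
    (hf : Function.Injective f) (hr : ∀ i, ∑ j, f i j ^ 2 = r) :
    LinearIndependent ℚ fun (i : Fin 2) j => ((f i.succ j - f 0 j : ℤ) : ℚ) := by
  set u : Fin d → ℚ := fun j => ((f 1 j - f 0 j : ℤ) : ℚ) with hu
  set v : Fin d → ℚ := fun j => ((f 2 j - f 0 j : ℤ) : ℚ) with hv
  set o : Fin d → ℚ := fun j => (f 0 j : ℚ) with ho
  have hu0 : u ≠ 0 := by
    intro h
    refine absurd (hf (?_ : f 1 = f 0)) (by decide)
    funext j
    have := congrFun h j
    simp only [hu, Pi.zero_apply, Int.cast_eq_zero] at this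
    exact sub_eq_zero.mp this
  have hv0 : v ≠ 0 := by
    intro h
    refine absurd (hf (?_ : f 2 = f 0)) (by decide)
    funext j
    have := congrFun h j
    simp only [hv, Pi.zero_apply, Int.cast_eq_zero] at this
    exact sub_eq_zero.mp this
  have huv : u ≠ v := by
    intro h
    refine absurd (hf (?_ : f 1 = f 2)) (by decide)
    funext j
    have := congrFun h j
    simp only [hu, hv, Int.cast_inj] at this
    exact sub_left_injective this
  have hsq : ∀ i : Fin 3, 2 * ∑ j, o j * ((f i j - f 0 j : ℤ) : ℚ) +
      ∑ j, ((f i j - f 0 j : ℤ) : ℚ) ^ 2 = 0 := by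
    intro i
    have h1 : ∑ j, (f i j ^ 2 - f 0 j ^ 2) = 0 := by
      rw [Finset.sum_sub_distrib, hr, hr, sub_self]
    have h2 : ((∑ j, (f i j ^ 2 - f 0 j ^ 2) : ℤ) : ℚ) = 0 := by rw [h1]; simp
    rw [← h2, Finset.mul_sum, ← Finset.sum_add_distrib, Int.cast_sum]
    refine Finset.sum_congr rfl fun j _ => ?_
    simp only [ho]
    push_cast
    ring
  have hfun : (fun (i : Fin 2) j => ((f i.succ j - f 0 j : ℤ) : ℚ)) = ![u, v] := by
    funext i
    fin_cases i <;> rfl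
  rw [hfun, linearIndependent_fin2]
  refine ⟨hv0, fun c hc => ?_⟩
  simp only [Matrix.cons_val_one, Matrix.cons_val_zero] at hc
  have e1 := hsq 1
  have e2 := hsq 2
  change 2 * ∑ j, o j * u j + ∑ j, u j ^ 2 = 0 at e1
  change 2 * ∑ j, o j * v j + ∑ j, v j ^ 2 = 0 at e2
  have hlin : ∑ j, o j * u j = c * ∑ j, o j * v j := by
    rw [← hc, Finset.mul_sum]
    exact Finset.sum_congr rfl fun j _ => by simp; ring
  have hquad : ∑ j, u j ^ 2 = c ^ 2 * ∑ j, v j ^ 2 := by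
    rw [← hc, Finset.mul_sum]
    exact Finset.sum_congr rfl fun j _ => by simp; ring
  have hvpos : ∑ j, v j ^ 2 ≠ 0 := by
    intro h
    rw [Finset.sum_eq_zero_iff_of_nonneg fun j _ => sq_nonneg _] at h
    exact hv0 (funext fun j => pow_eq_zero_iff two_ne_zero |>.mp (h j (Finset.mem_univ j)))
  -- A line through a point of the sphere meets it at most once more: with `u = c • v` the sphere
  -- equations leave only `c = 0` or `c = 1`.
  have hprod : c * (c - 1) * ∑ j, v j ^ 2 = 0 := by
    rw [hlin, hquad] at e1
    linear_combination e1 - c * e2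
  rcases mul_eq_zero.mp ((mul_eq_zero.mp hprod).resolve_right hvpos) with h | h
  · rw [h, zero_smul] at hc
    exact hu0 hc.symm
  · rw [sub_eq_zero.mp h, one_smul] at hc
    exact huv hc.symm

/-- `m` lattice points on a sphere in a box of side `O(m ^ (1 / (d - 2)))`. -/
theorem exists_sphere_points {d m : ℕ} (hd : 3 ≤ d) (hm : 1 ≤ m) :
    ∃ (a : ℕ) (P : Finset (Fin d → ℤ)), 1 ≤ a ∧
      (a : ℝ) ≤ 2 * d * (m : ℝ) ^ (1 / ((d - 2 : ℕ) : ℝ)) ∧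
      P.card = m ∧ (∀ x ∈ P, ∀ i, 0 ≤ x i ∧ x i ≤ a) ∧
      ∀ f : Fin (2 + 1) → Fin d → ℤ, Function.Injective f → (∀ i, f i ∈ P) →
        LinearIndependent ℚ fun (i : Fin 2) j => ((f i.succ j - f 0 j : ℤ) : ℚ) := by
  classical
  -- The `a ^ d` box points have fewer than `d * a ^ 2 + 1` squared norms, so `a ^ (d - 2) ≥ d * m`
  -- puts `m` of them on one sphere.
  obtain ⟨a, ha1, ha2, ha3⟩ := exists_nat_root (g := d - 2) (k := d * m) (by omega)
    (Nat.mul_pos (by omega) hm)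
  obtain ⟨r, -, hr⟩ := Finset.exists_le_card_fiber_of_mul_le_card_of_maps_to
    (s := latticeBox d a) (t := Finset.Ico (0 : ℤ) (d * a ^ 2 : ℕ)) (f := fun x => ∑ j, x j ^ 2)
    (n := m) (by
      intro x hx
      have hx' := mem_latticeBox.mp hx
      rw [Finset.mem_Ico]
      refine ⟨Finset.sum_nonneg fun j _ => sq_nonneg _, ?_⟩
      have hlt : ∑ j, x j ^ 2 < ∑ _j : Fin d, (a : ℤ) ^ 2 := by
        refine Finset.sum_lt_sum_of_nonempty ⟨⟨0, by omega⟩, Finset.mem_univ _⟩ fun j _ => ?_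
        exact pow_lt_pow_left₀ (hx' j).2 (hx' j).1 two_ne_zero
      simpa using hlt)
    ⟨0, by
      rw [Finset.mem_Ico]
      refine ⟨le_rfl, ?_⟩
      have : 0 < d * a ^ 2 := Nat.mul_pos (by omega) (pow_pos ha1 2)
      exact_mod_cast this⟩
    (by
      rw [card_latticeBox, Int.card_Ico, sub_zero, Int.toNat_natCast]
      calc d * a ^ 2 * m = d * m * a ^ 2 := by ring
        _ ≤ a ^ (d - 2) * a ^ 2 := Nat.mul_le_mul_right _ ha3
        _ = a ^ d := by rw [← pow_add]; congr 1; omega)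
  obtain ⟨P, hP, hPc⟩ := Finset.exists_subset_card_eq hr
  refine ⟨a, P, ha1, ?_, hPc, ?_, ?_⟩
  · refine ha2.trans ?_
    push_cast
    rw [Real.mul_rpow (by positivity) (by positivity), ← mul_assoc]
    have hd' : (1 : ℝ) ≤ d := by exact_mod_cast (by omega : 1 ≤ d)
    have hg : (1 : ℝ) ≤ ((d - 2 : ℕ) : ℝ) := by exact_mod_cast (by omega : 1 ≤ d - 2)
    have h1 : (d : ℝ) ^ (1 / ((d - 2 : ℕ) : ℝ)) ≤ d := by
      conv_rhs => rw [← Real.rpow_one (d : ℝ)]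
      exact Real.rpow_le_rpow_of_exponent_le hd' (by rw [div_le_one (by linarith)]; exact hg)
    gcongr
  · intro x hx i
    have := mem_latticeBox.mp (Finset.mem_filter.mp (hP hx)).1 i
    exact ⟨this.1, this.2.le⟩
  · intro f hf hfP
    exact linearIndependent_of_sphere (r := r) f hf fun i => (Finset.mem_filter.mp (hP (hfP i))).2

/-! ### Choice of parameters -/

/-- The incidence bound for any supply of lattice points, `m` of them in a box of side
`O(m ^ (1 / g))`, whose `(s + 1)`-tuples are affinely independent. -/
theorem exists_many_incidences {d s g : ℕ} (hs : 1 ≤ s) (hsd : s + 1 ≤ d)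
    (hpts : ∀ m : ℕ, 1 ≤ m → ∃ (a : ℕ) (P : Finset (Fin d → ℤ)), 1 ≤ a ∧
      (a : ℝ) ≤ 2 * d * (m : ℝ) ^ (1 / (g : ℝ)) ∧
      P.card = m ∧ (∀ x ∈ P, ∀ i, 0 ≤ x i ∧ x i ≤ a) ∧
      ∀ f : Fin (s + 1) → Fin d → ℤ, Function.Injective f → (∀ i, f i ∈ P) →
        LinearIndependent ℚ fun (i : Fin s) j => ((f i.succ j - f 0 j : ℤ) : ℚ))
    (δ : ℝ) (hδ : δ = (d * s : ℝ) / (d * s + d - 1)) :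
    ∃ c : ℝ, 0 < c ∧ ∀ m n : ℕ, 1 ≤ m → 1 ≤ n →
      ∃ (P : Finset (EuclideanSpace ℝ (Fin d)))
        (H : Finset (AffineSubspace ℝ (EuclideanSpace ℝ (Fin d)))),
        P.card = m ∧ H.card = n ∧ (∀ h ∈ H, IsHyperplane h) ∧
        ¬ ContainsK (s + 1) (∏ j : Fin d, 2 ^ (j : ℕ) + 1) P H ∧
        c * ((m : ℝ) ^ (1 - δ / g) * (n : ℝ) ^ δ + m + n) ≤ incidences P H := by
  have hd1 : (2 : ℝ) ≤ d := by exact_mod_cast (by omega : 2 ≤ d)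
  have hs1 : (1 : ℝ) ≤ s := by exact_mod_cast hs
  set e : ℕ := d * s + d - 1 with he
  have heR : (e : ℝ) = d * s + d - 1 := by
    rw [he, Nat.cast_sub (by omega)]; push_cast; ring
  have hds : (2 : ℝ) ≤ d * s := by nlinarith
  have he0 : (0 : ℝ) < e := by rw [heR]; linarith
  have hδ0 : 0 ≤ δ := by rw [hδ, ← heR]; positivity
  have hδ1 : δ ≤ 1 := by rw [hδ, ← heR, div_le_one he0, heR]; linarith
  have hδe : e * δ = ((d * s : ℕ) : ℝ) := by
    rw [hδ, ← heR]; push_cast; field_simp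
  set C₁ : ℝ := 10 * d ^ 2 with hC₁
  have hC₁1 : 1 ≤ C₁ := by rw [hC₁]; nlinarith
  set C : ℝ := C₁ * (2 * d) ^ (d * s) with hC
  have hC0 : 0 < C := by positivity
  refine ⟨1 / (2 * (C + 1)), by positivity, fun m n hm hn => ?_⟩
  have hm1 : (1 : ℝ) ≤ m := by exact_mod_cast hm
  have hn1 : (1 : ℝ) ≤ n := by exact_mod_cast hn
  set main : ℝ := (m : ℝ) ^ (1 - δ / g) * (n : ℝ) ^ δ with hmain
  -- If `m + n` dominates, the double star suffices; otherwise `q = ⌊z⌋₊` works. The factor `(2 * d)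
  -- ^ (d * s)` in `C` forces `q ≥ d` and absorbs the rounding loss `z ≤ 2 * q`.
  by_cases hcase : main ≤ C * (m + n)
  · obtain ⟨P, H, hPc, hHc, hh, hK, hI⟩ := exists_double_star (d := d) (by omega) hm hn
    refine ⟨P, H, hPc, hHc, hh, fun h => hK (h.mono (by omega) ?_), ?_⟩
    · have : 1 ≤ ∏ j : Fin d, 2 ^ (j : ℕ) := Finset.one_le_prod' fun j _ => Nat.one_le_two_pow
      omega
    · have hI' : (m : ℝ) + n ≤ incidences P H + 1 := by exact_mod_cast hI
      rw [div_mul_eq_mul_div, one_mul, div_le_iff₀ (by positivity)]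
      nlinarith
  push Not at hcase
  obtain ⟨a, P, ha1, ha2, hPc, hPb, hgen⟩ := hpts m hm
  have ha1' : (1 : ℝ) ≤ a := by exact_mod_cast ha1
  -- `z` is the real solution of `5 * d * a * z ^ e = n`, the largest admissible `q` before
  -- rounding.
  set Z : ℝ := n / (5 * d * a) with hZ
  have hZ0 : 0 < Z := by positivity
  set z : ℝ := Z ^ (1 / (e : ℝ)) with hz
  have hz0 : 0 < z := Real.rpow_pos_of_pos hZ0 _
  have hze : z ^ e = Z := by
    rw [hz, ← Real.rpow_natCast, ← Real.rpow_mul hZ0.le, one_div_mul_cancel he0.ne', Real.rpow_one]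
  have hmain_le : main ≤ C₁ * (m * z ^ (d * s)) := by
    have hmg : 0 < (m : ℝ) ^ (1 / (g : ℝ)) := by positivity
    have h1 : main = m * (n / (m : ℝ) ^ (1 / (g : ℝ))) ^ δ := by
      rw [hmain, Real.div_rpow (by positivity) hmg.le, ← Real.rpow_mul (by positivity),
        Real.rpow_sub (by positivity), Real.rpow_one, one_div_mul_eq_div]
      ring
    have h2 : n / (m : ℝ) ^ (1 / (g : ℝ)) ≤ C₁ * Z := by
      have h3 : C₁ * Z = n * (2 * d / a) := by rw [hC₁, hZ]; field_simp; ring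
      rw [h3, div_eq_mul_inv]
      gcongr
      rw [inv_eq_one_div, div_le_div_iff₀ hmg (by positivity)]
      linarith
    have h4 : (C₁ * Z) ^ δ ≤ C₁ * z ^ (d * s) := by
      rw [Real.mul_rpow (by positivity) hZ0.le]
      have h5 : Z ^ δ = z ^ (d * s) := by
        rw [← hze, ← Real.rpow_natCast z e, ← Real.rpow_mul hz0.le, hδe, Real.rpow_natCast]
      rw [h5]
      gcongr
      conv_rhs => rw [← Real.rpow_one C₁]
      exact Real.rpow_le_rpow_of_exponent_le hC₁1 hδ1
    rw [h1]
    calc (m : ℝ) * (n / (m : ℝ) ^ (1 / (g : ℝ))) ^ δ ≤ m * (C₁ * Z) ^ δ := by gcongr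
      _ ≤ m * (C₁ * z ^ (d * s)) := by gcongr
      _ = _ := by ring
  have hdq : d ≤ ⌊z⌋₊ := by
    by_contra hcon
    push Not at hcon
    have hzd : z ≤ 2 * d := by
      have := (Nat.floor_lt hz0.le).mp hcon
      linarith
    have : main ≤ C * m := by
      calc main ≤ C₁ * (m * z ^ (d * s)) := hmain_le
        _ ≤ C₁ * (m * (2 * d) ^ (d * s)) := by gcongr
        _ = C * m := by rw [hC]; ring
    nlinarith
  have hqz : z ≤ 2 * (⌊z⌋₊ : ℝ) := by
    have h1 := Nat.lt_floor_add_one z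
    have h2 : (d : ℝ) ≤ (⌊z⌋₊ : ℝ) := by exact_mod_cast hdq
    linarith
  have hn' : 5 * d * a * ⌊z⌋₊ ^ (d * s + d - 1) ≤ n := by
    have h1 : (⌊z⌋₊ : ℝ) ^ e ≤ Z := by
      rw [← hze]
      exact pow_le_pow_left₀ (by positivity) (Nat.floor_le hz0.le) e
    have h2 : (5 * d * a : ℝ) * (⌊z⌋₊ : ℝ) ^ e ≤ n := by
      rw [hZ, le_div_iff₀ (by positivity)] at h1
      linarith
    exact_mod_cast h2
  obtain ⟨Q, H, hQc, hHc, hh, hK, hI⟩ := exists_hyperplanes_of_points hsd hdq ha1 P hPb hgen hn'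
  refine ⟨Q, H, hQc.trans hPc, hHc, hh, hK, ?_⟩
  have hI' : (m : ℝ) * (⌊z⌋₊ : ℝ) ^ (d * s) ≤ incidences Q H := by
    rw [← hPc]; exact_mod_cast hI
  have hmI : main ≤ C * incidences Q H := by
    calc main ≤ C₁ * (m * z ^ (d * s)) := hmain_le
      _ ≤ C₁ * (m * (2 * (⌊z⌋₊ : ℝ)) ^ (d * s)) := by gcongr
      _ = C₁ * 2 ^ (d * s) * (m * (⌊z⌋₊ : ℝ) ^ (d * s)) := by rw [mul_pow]; ring
      _ ≤ C₁ * (2 * d) ^ (d * s) * incidences Q H := by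
        gcongr
        linarith
  have hmn : (m : ℝ) + n ≤ incidences Q H := by
    by_contra hcon
    push Not at hcon
    have := mul_lt_mul_of_pos_left hcon hC0
    linarith
  rw [div_mul_eq_mul_div, one_mul, div_le_iff₀ (by positivity)]
  nlinarith

theorem theorem1p3 (d : ℕ) (hd : 2 ≤ d) :
    ∃ t : ℕ, ∀ ε : ℝ, 0 < ε →
      (∀ C : ℝ, ∃ c : ℝ, 0 < c ∧
        ∀ m n : ℕ, 1 ≤ m → 1 ≤ n → (m : ℝ) ≤ C * (n : ℝ) ^ d →
          ∃ (P : Finset (EuclideanSpace ℝ (Fin d)))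
            (H : Finset (AffineSubspace ℝ (EuclideanSpace ℝ (Fin d)))),
            P.card = m ∧ H.card = n ∧ (∀ h ∈ H, IsHyperplane h) ∧
            ¬ ContainsK 2 (t + 1) P H ∧
            c * ((m : ℝ) ^ ((2 * (d : ℝ) - 2) / (2 * (d : ℝ) - 1)) *
                  (n : ℝ) ^ ((d : ℝ) / (2 * (d : ℝ) - 1) - ε) + (m : ℝ) + (n : ℝ))
              ≤ (incidences P H : ℝ)) ∧
      (4 ≤ d → ∀ C : ℝ, ∃ c : ℝ, 0 < c ∧
        ∀ m n : ℕ, 1 ≤ m → 1 ≤ n → (m : ℝ) ≤ C * (n : ℝ) ^ (d - 2) →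
          ∃ (P : Finset (EuclideanSpace ℝ (Fin d)))
            (H : Finset (AffineSubspace ℝ (EuclideanSpace ℝ (Fin d)))),
            P.card = m ∧ H.card = n ∧ (∀ h ∈ H, IsHyperplane h) ∧
            ¬ ContainsK 3 (t + 1) P H ∧
            c * ((m : ℝ) ^ ((3 * (d : ℝ) ^ 2 - 9 * (d : ℝ) + 2) /
                    (((d : ℝ) - 2) * (3 * (d : ℝ) - 1))) *
                  (n : ℝ) ^ (2 * (d : ℝ) / (3 * (d : ℝ) - 1) - ε) + (m : ℝ) + (n : ℝ))
              ≤ (incidences P H : ℝ)) := by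
  have hd2 : (2 : ℝ) ≤ d := by exact_mod_cast hd
  -- The construction attains the bound with `ε = 0`; since `n ≥ 1`, lowering the exponent only
  -- weakens it.
  have drop : ∀ (m n : ℕ) (c x y ε : ℝ), 1 ≤ n → 0 < c → 0 < ε →
      c * ((m : ℝ) ^ x * (n : ℝ) ^ (y - ε) + m + n) ≤ c * ((m : ℝ) ^ x * (n : ℝ) ^ y + m + n) := by
    intro m n c x y ε hn hc hε
    have hn1 : (1 : ℝ) ≤ n := by exact_mod_cast hn
    have := Real.rpow_le_rpow_of_exponent_le hn1 (by linarith : y - ε ≤ y)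
    gcongr
  refine ⟨∏ j : Fin d, 2 ^ (j : ℕ), fun ε hε => ⟨fun _ => ?_, fun hd4 _ => ?_⟩⟩
  · obtain ⟨c, hc, h⟩ := exists_many_incidences (d := d) (s := 1) (g := d) le_rfl hd
      (fun m hm => exists_box_points (by omega) hm) (d / (2 * d - 1)) (by push_cast; ring_nf)
    refine ⟨c, hc, fun m n hm hn _ => ?_⟩
    obtain ⟨P, H, h1, h2, h3, h4, h5⟩ := h m n hm hn
    refine ⟨P, H, h1, h2, h3, h4, (drop m n c _ _ ε hn hc hε).trans ?_⟩
    have hexp : (2 * (d : ℝ) - 2) / (2 * d - 1) = 1 - d / (2 * d - 1) / d := by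
      have : 2 * (d : ℝ) - 1 ≠ 0 := by linarith
      field_simp
      ring
    rw [hexp]
    exact h5
  · obtain ⟨c, hc, h⟩ := exists_many_incidences (d := d) (s := 2) (g := d - 2) (by norm_num)
      (by omega) (fun m hm => exists_sphere_points (by omega) hm) (2 * d / (3 * d - 1))
      (by push_cast; ring_nf)
    refine ⟨c, hc, fun m n hm hn _ => ?_⟩
    obtain ⟨P, H, h1, h2, h3, h4, h5⟩ := h m n hm hn
    refine ⟨P, H, h1, h2, h3, h4, (drop m n c _ _ ε hn hc hε).trans ?_⟩
    have hd4' : (4 : ℝ) ≤ d := by exact_mod_cast hd4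
    have hexp : (3 * (d : ℝ) ^ 2 - 9 * d + 2) / ((d - 2) * (3 * d - 1)) =
        1 - 2 * d / (3 * d - 1) / ((d - 2 : ℕ) : ℝ) := by
      rw [Nat.cast_sub (by omega)]
      push_cast
      have h6 : 3 * (d : ℝ) - 1 ≠ 0 := by linarith
      have h7 : (d : ℝ) - 2 ≠ 0 := by linarith
      field_simp
      ring
    rw [hexp]
    exact h5
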